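/- For integers $k\ge 1$, $d\ge 0$ and a real $R\ge 0$, call a probability measure $\Gamma$ on $\mathbb R^d$ a $k$-atomic distribution supported on $B(0,R)$ if $\Gamma=\sum_{j=1}^k w_j\delta_{\mu_j}$ with $w_j\ge 0$, $\sum_{j=1}^k w_j=1$, $\mu_j\in\mathbb R^d$ and $\|\mu_j\|_2\le R$ (atoms may coincide and weights may vanish). Let $P_\Gamma=\Gamma * N(0,I_d)$ be the Gaussian mixture with mixing distribution $\Gamma$, let $M_\ell(\Gamma)=\mathbb E_{U\sim\Gamma}[U^{\otimes \ell}]=\sum_{j=1}^k w_j\mu_j^{\otimes\ell}$ be the order-$\ell$ moment tensor, and let $\|T\|_F=\big(\sum_{j_1,\dots,j_\ell=1}^d T_{j_1,\dots,j_\ell}^2\big)^{1/2}$ be the Frobenius norm of an order-$\ell$ tensor. For probability measures $P,Q$ with densities $p,q$ with respect to a common dominating measure $\mu$, let $H^2(P,Q)=\int(\sqrt p-\sqrt q)^2\,d\mu$ and, if $P\ll Q$, $\mathrm{KL}(P,Q)=\int p\log\frac pq\,d\mu$ and $\chi^2(P,Q)=\int\frac{(p-q)^2}{q}\,d\mu$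 (both are $+\infty$ if $P\not\ll Q$). Theorem (Moment characterization of statistical distances). For every $R\ge 0$ there is a constant $C>0$, depending only on $R$ (and not on $k$ or $d$), such that for all integers $k\ge 1$ and $d\ge 0$, all $k$-atomic distributions $\Gamma,\Gamma'$ supported on the ball $B(0,R)$ in $\mathbb R^d$, and every $D\in\{H^2,\mathrm{KL},\chi^2\}$, $$ (Ck)^{-4k}\max_{\ell\le 2k-1}\|M_\ell(\Gamma)-M_\ell(\Gamma')\|_F^2\;\le\; D(P_\Gamma,P_{\Gamma'})\;\le\; C e^{36k^2}\max_{\ell\le 2k-1}\|M_\ell(\Gamma)-M_\ell(\Gamma')\|_F^2 . $$ -/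

import Mathlib

open MeasureTheory
open scoped ENNReal

noncomputable section

/-- The Euclidean space `ℝ^d`. -/
abbrev Rd (d : ℕ) : Type := EuclideanSpace ℝ (Fin d)

/-- The `k`-atomic distributions `∑ j, w j • δ_(μ j)` on `ℝ^d` supported on the closed ball
`B(0,R)`: `w` is a probability vector of length `k` and `‖μ j‖ ≤ R`. Weights may vanish and
atoms may coincide. -/
def kAtomic (k d : ℕ) (R : ℝ) : Set (Measure (Rd d)) :=
  {Γ | ∃ w : Fin k → ℝ, ∃ μ : Fin k → Rd d,
    (∀ j, 0 ≤ w j) ∧ ∑ j, w j = 1 ∧ (∀ j, ‖μ j‖ ≤ R) ∧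
      Γ = ∑ j, ENNReal.ofReal (w j) • Measure.dirac (μ j)}

/-- The Gaussian mixture `P_Γ = Γ * N(0, I_d)` with mixing distribution `Γ`. -/
def gaussianMixture {d : ℕ} (Γ : Measure (Rd d)) : Measure (Rd d) :=
  Measure.conv Γ (ProbabilityTheory.stdGaussian (Rd d))

/-- The order-`ℓ` moment tensor `M_ℓ(Γ) = E[U ⊗ ⋯ ⊗ U]`, `U ∼ Γ`, given by its entries
`E[U_(j 1) ⋯ U_(j ℓ)]`. -/
def momentTensor {d : ℕ} (ℓ : ℕ) (Γ : Measure (Rd d)) : (Fin ℓ → Fin d) → ℝ :=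
  fun j => ∫ u, ∏ i, u (j i) ∂Γ

/-- The Frobenius norm of an order-`ℓ` tensor. -/
def frobeniusNorm {d ℓ : ℕ} (T : (Fin ℓ → Fin d) → ℝ) : ℝ :=
  Real.sqrt (∑ j, T j ^ 2)

/-- `max_{ℓ ≤ 2k-1} ‖M_ℓ(Γ) - M_ℓ(Γ')‖_F²`. The order `ℓ = 0` contributes `0` when both are
probability measures. -/
def maxMomentDiffSq {d : ℕ} (k : ℕ) (Γ Γ' : Measure (Rd d)) : ℝ :=
  (Finset.Iic (2 * k - 1)).sup' Finset.nonempty_Iic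
    fun ℓ => frobeniusNorm (momentTensor ℓ Γ - momentTensor ℓ Γ') ^ 2

/-- The squared Hellinger distance `∫ (√p - √q)² dμ`, where `p`, `q` are the densities of `P`, `Q`
with respect to the dominating measure `μ = P + Q`. -/
def hellingerSq {α : Type*} [MeasurableSpace α] (P Q : Measure α) : ℝ≥0∞ :=
  ∫⁻ x, ENNReal.ofReal ((Real.sqrt (P.rnDeriv (P + Q) x).toReal
    - Real.sqrt (Q.rnDeriv (P + Q) x).toReal) ^ 2) ∂(P + Q)

open Classical in
/-- The `χ²`-divergence `∫ (p - q)² / q dμ` of `P` from `Q`, taken with `μ = Q`, so that `q = 1` and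
`p = dP/dQ`; it is `∞` unless `P ≪ Q`. -/
def chiSqDiv {α : Type*} [MeasurableSpace α] (P Q : Measure α) : ℝ≥0∞ :=
  if P ≪ Q then ∫⁻ x, ENNReal.ofReal (((P.rnDeriv Q x).toReal - 1) ^ 2) ∂Q else ∞

end

/-!
The Gram kernel of the tensors `x i ⊗ ⋯ ⊗ x i` of order `l` is the pointwise power
`⟪x i, x j⟫ ^ l`, so the squared norm of `∑ i, a i • (x i ⊗ ⋯ ⊗ x i)` is the quadratic form of that
power at `a`. Taking for `x` the at most `2k` atoms of `Γ` and `Γ'` and for `a` the weights of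
`Γ - Γ'`, these forms are the squared moment differences. Newton interpolation at the atoms bounds
the form of every order, after any bounded translation of the atoms, by the maximum `M` of the
forms of order below `2k`, with a factor that is only geometric in the order.

Let `f = p - q` be the difference of the densities with respect to the standard Gaussian measure.
The integral of `f ^ 2` against a shifted Gaussian is, up to a factor, the exponential series
`∑ l, ⟪x i + c, x j + c⟫ ^ l / l!` of such forms, hence bounded by a multiple of `M`. By Jensen's
inequality `1 / q` is bounded by a shifted Gaussian density, so that `χ²` is at most a multiple of
`M`. Conversely, testing `P - Q` against `f` itself gives the unshifted exponential series, which
is at least any of its terms; Cauchy–Schwarz then bounds the Hellinger distance from below. The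
remaining cases follow from `H² ≤ KL ≤ χ²`.
-/

lemma exists_seq_enumerating_of_norm_le {ι E : Type*} [Fintype ι] [SeminormedAddCommGroup E]
    {x : ι → E} {r : ℝ} (hr : 0 ≤ r) (hx : ∀ i, ‖x i‖ ≤ r) :
    ∃ s : ℕ → E, (∀ t, ‖s t‖ ≤ r) ∧ ∀ i, ∃ t < Fintype.card ι, s t = x i := by
  let e := Fintype.equivFin ι
  refine ⟨fun t => if h : t < Fintype.card ι then x (e.symm ⟨t, h⟩) else 0, fun t => ?_,
    fun i => ⟨e i, (e i).2, by simp⟩⟩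
  dsimp only
  split_ifs with h
  · exact hx _
  · simpa using hr

section Kernel

open scoped InnerProductSpace

variable {ι E : Type*} [NormedAddCommGroup E] [InnerProductSpace ℝ E]

/-- The Gram kernel of a family of vectors. The kernel trick turns statements on tensors into
statements on kernels: the pointwise power `gramKernel x ^ l` is the Gram kernel of the family
of tensors `x i ⊗ ⋯ ⊗ x i` of order `l`. -/
def gramKernel (x : ι → E) : ι → ι → ℝ := fun i j => ⟪x i, x j⟫_ℝ

variable (ι) in
/-- The positive semidefinite kernels, which form a monoid under pointwise multiplication by the
Schur product theorem. -/
def posSemidefKernel [Finite ι] : Submonoid (ι → ι → ℝ) where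
  carrier := {K | (Matrix.of K).PosSemidef}
  one_mem' := by
    have h := Matrix.posSemidef_gram ℝ fun _ : ι => (1 : ℝ)
    have h1 : Matrix.of (1 : ι → ι → ℝ) = Matrix.gram ℝ fun _ : ι => (1 : ℝ) := by
      ext i j
      simp [Matrix.gram]
    simpa only [Set.mem_ofPred_eq, h1] using h
  mul_mem' hK hL := hK.hadamard hL

lemma gramKernel_mem_posSemidefKernel [Finite ι] (x : ι → E) :
    gramKernel x ∈ posSemidefKernel ι :=
  Matrix.posSemidef_gram ℝ x

lemma exists_gramKernel_eq [Finite ι] {K : ι → ι → ℝ} (hK : K ∈ posSemidefKernel ι) :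
    ∃ (m : ℕ) (v : ι → EuclideanSpace ℝ (Fin m)), gramKernel v = K := by
  have := Fintype.ofFinite ι
  obtain ⟨m, v, hv⟩ := Matrix.posSemidef_iff_eq_sum_vecMulVec.1 hK
  refine ⟨m, fun i => WithLp.toLp 2 fun h => v h i, ?_⟩
  ext i j
  have hij := congrFun₂ hv i j
  rw [Matrix.of_apply] at hij
  simp [hij, gramKernel, PiLp.inner_apply, Matrix.sum_apply, Matrix.vecMulVec_apply, mul_comm]

open scoped TensorProduct in
lemma gramKernel_mul_gramKernel {F : Type*} [NormedAddCommGroup F] [InnerProductSpace ℝ F]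
    (u : ι → E) (v : ι → F) :
    gramKernel u * gramKernel v = gramKernel fun i => u i ⊗ₜ[ℝ] v i := by
  ext i j
  simp [gramKernel]

/-- The kernel analogue of the Newton polynomial with nodes `s 0, …, s (j - 1)`: the Gram kernel
of the tensors `(x i - s 0) ⊗ ⋯ ⊗ (x i - s (j - 1))`. -/
def newtonKernel (x : ι → E) (s : ℕ → E) (j : ℕ) : ι → ι → ℝ :=
  ∏ t ∈ Finset.range j, gramKernel fun i => x i - s t

lemma newtonKernel_mem_posSemidefKernel [Finite ι] (x : ι → E) (s : ℕ → E) (j : ℕ) :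
    newtonKernel x s j ∈ posSemidefKernel ι :=
  prod_mem fun _ _ => gramKernel_mem_posSemidefKernel _

lemma newtonKernel_succ (x : ι → E) (s : ℕ → E) (j : ℕ) :
    newtonKernel x s (j + 1) = gramKernel (fun i => x i - s j) * newtonKernel x s j := by
  rw [newtonKernel, Finset.prod_range_succ, mul_comm, newtonKernel]

lemma newtonKernel_eq_zero {x : ι → E} {s : ℕ → E} {j : ℕ} (hs : ∀ i, ∃ t < j, s t = x i) :
    newtonKernel x s j = 0 := by
  ext i i'
  obtain ⟨t, ht, hst⟩ := hs i
  simp only [newtonKernel, Finset.prod_apply, Pi.zero_apply]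
  exact Finset.prod_eq_zero (Finset.mem_range.2 ht) (by simp [gramKernel, hst])

variable [Fintype ι]

/-- The quadratic form of the kernel `K` at the coefficients `a`. -/
def kernelForm (a : ι → ℝ) (K : ι → ι → ℝ) : ℝ := ∑ i, ∑ j, a i * a j * K i j

/-- The seminorm of the coefficients `a` induced by the positive semidefinite kernel `K`, that is
the norm of `∑ i, a i • v i` for vectors `v i` with Gram kernel `K`. -/
noncomputable def kernelNorm (a : ι → ℝ) (K : ι → ι → ℝ) : ℝ := √(kernelForm a K)

lemma kernelNorm_nonneg (a : ι → ℝ) (K : ι → ι → ℝ) : 0 ≤ kernelNorm a K := Real.sqrt_nonneg _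

lemma kernelNorm_zero (a : ι → ℝ) : kernelNorm a 0 = 0 := by
  simp [kernelNorm, kernelForm]

lemma kernelForm_gramKernel (a : ι → ℝ) (v : ι → E) :
    kernelForm a (gramKernel v) = ‖∑ i, a i • v i‖ ^ 2 := by
  rw [← real_inner_self_eq_norm_sq, sum_inner]
  simp_rw [inner_sum, real_inner_smul_left, real_inner_smul_right, ← mul_assoc]
  rfl

lemma kernelNorm_gramKernel (a : ι → ℝ) (v : ι → E) :
    kernelNorm a (gramKernel v) = ‖∑ i, a i • v i‖ := by
  rw [kernelNorm, kernelForm_gramKernel, Real.sqrt_sq (norm_nonneg _)]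

lemma kernelForm_nonneg (a : ι → ℝ) {K : ι → ι → ℝ} (hK : K ∈ posSemidefKernel ι) :
    0 ≤ kernelForm a K := by
  obtain ⟨m, v, rfl⟩ := exists_gramKernel_eq hK
  rw [kernelForm_gramKernel]
  positivity

lemma kernelNorm_sq (a : ι → ℝ) {K : ι → ι → ℝ} (hK : K ∈ posSemidefKernel ι) :
    kernelNorm a K ^ 2 = kernelForm a K :=
  Real.sq_sqrt (kernelForm_nonneg a hK)

lemma kernelNorm_gramKernel_sub_mul_le (a : ι → ℝ) {K : ι → ι → ℝ} (hK : K ∈ posSemidefKernel ι)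
    (x : ι → E) (c c' : E) :
    kernelNorm a (gramKernel (fun i => x i - c) * K)
      ≤ kernelNorm a (gramKernel (fun i => x i - c') * K) + ‖c' - c‖ * kernelNorm a K := by
  obtain ⟨m, v, rfl⟩ := exists_gramKernel_eq hK
  have split : ∑ i, a i • (x i - c) ⊗ₜ[ℝ] v i
      = ∑ i, a i • (x i - c') ⊗ₜ[ℝ] v i + (c' - c) ⊗ₜ[ℝ] ∑ i, a i • v i := by
    simp_rw [TensorProduct.tmul_sum, TensorProduct.tmul_smul, ← Finset.sum_add_distrib,
      ← smul_add, ← TensorProduct.add_tmul, sub_add_sub_cancel]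
  simp_rw [gramKernel_mul_gramKernel, kernelNorm_gramKernel, split]
  exact (norm_add_le _ _).trans_eq (by rw [TensorProduct.norm_tmul])

variable {a : ι → ℝ} {x : ι → E} {s : ℕ → E} {r δ : ℝ} {n : ℕ}

lemma kernelNorm_pow_mul_newtonKernel_le (hs : ∀ t, ‖s t‖ ≤ r)
    (hδ : ∀ l < n, kernelNorm a (gramKernel x ^ l) ≤ δ) {l j : ℕ} (hlj : l + j < n) :
    kernelNorm a (gramKernel x ^ l * newtonKernel x s j) ≤ (1 + r) ^ j * δ := by
  induction j generalizing l with
  | zero => simpa [newtonKernel] using hδ l hlj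
  | succ j ih =>
    have hK := mul_mem (pow_mem (gramKernel_mem_posSemidefKernel x) l)
      (newtonKernel_mem_posSemidefKernel x s j)
    have hstep := kernelNorm_gramKernel_sub_mul_le a hK x (s j) 0
    simp only [sub_zero, zero_sub, norm_neg] at hstep
    calc kernelNorm a (gramKernel x ^ l * newtonKernel x s (j + 1))
        = kernelNorm a (gramKernel (fun i => x i - s j)
            * (gramKernel x ^ l * newtonKernel x s j)) := by rw [newtonKernel_succ, mul_left_comm]
      _ ≤ kernelNorm a (gramKernel x ^ (l + 1) * newtonKernel x s j)
            + ‖s j‖ * kernelNorm a (gramKernel x ^ l * newtonKernel x s j) := by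
        rwa [pow_succ', mul_assoc]
      _ ≤ (1 + r) ^ j * δ + r * ((1 + r) ^ j * δ) := by
        have hr := (norm_nonneg _).trans (hs j)
        gcongr
        exacts [ih (by omega), kernelNorm_nonneg _ _, hs j, ih (by omega)]
      _ = (1 + r) ^ (j + 1) * δ := by ring

lemma kernelNorm_pow_sub_mul_newtonKernel_le (hs : ∀ t, ‖s t‖ ≤ r)
    (hx : ∀ i, ∃ t < n, s t = x i) (hδ0 : 0 ≤ δ)
    (hδ : ∀ l < n, kernelNorm a (gramKernel x ^ l) ≤ δ) {c : E} (hc : ‖c‖ ≤ r) (l j : ℕ) :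
    kernelNorm a (gramKernel (fun i => x i - c) ^ l * newtonKernel x s j)
      ≤ (1 + 3 * r) ^ l * (1 + r) ^ j * δ := by
  have hr : 0 ≤ r := (norm_nonneg c).trans hc
  induction l generalizing j with
  | zero =>
    rcases lt_or_ge j n with hj | hj
    · simpa using kernelNorm_pow_mul_newtonKernel_le hs hδ (l := 0) (by omega)
    · have hx' : ∀ i, ∃ t < j, s t = x i := fun i => (hx i).imp fun _ ht => ⟨ht.1.trans_le hj, ht.2⟩
      rw [newtonKernel_eq_zero hx', mul_zero, kernelNorm_zero]
      positivity
  | succ l ih =>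
    set G := gramKernel fun i => x i - c
    have hK := mul_mem (pow_mem (gramKernel_mem_posSemidefKernel fun i => x i - c) l)
      (newtonKernel_mem_posSemidefKernel x s j)
    have hdist : ‖s j - c‖ ≤ 2 * r := (norm_sub_le _ _).trans (by linarith [hs j])
    calc kernelNorm a (G ^ (l + 1) * newtonKernel x s j)
        = kernelNorm a (G * (G ^ l * newtonKernel x s j)) := by rw [pow_succ', mul_assoc]
      _ ≤ kernelNorm a (gramKernel (fun i => x i - s j) * (G ^ l * newtonKernel x s j))
            + ‖s j - c‖ * kernelNorm a (G ^ l * newtonKernel x s j) :=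
        kernelNorm_gramKernel_sub_mul_le a hK x c (s j)
      _ = kernelNorm a (G ^ l * newtonKernel x s (j + 1))
            + ‖s j - c‖ * kernelNorm a (G ^ l * newtonKernel x s j) := by
        rw [newtonKernel_succ, mul_left_comm]
      _ ≤ (1 + 3 * r) ^ l * (1 + r) ^ (j + 1) * δ
            + 2 * r * ((1 + 3 * r) ^ l * (1 + r) ^ j * δ) := by
        gcongr
        exacts [ih (j + 1), kernelNorm_nonneg _ _, ih j]
      _ = (1 + 3 * r) ^ (l + 1) * (1 + r) ^ j * δ := by ring

lemma kernelNorm_pow_sub_le (hx : ∀ i, ‖x i‖ ≤ r) (hδ0 : 0 ≤ δ)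
    (hδ : ∀ l < Fintype.card ι, kernelNorm a (gramKernel x ^ l) ≤ δ) {c : E} (hc : ‖c‖ ≤ r)
    (l : ℕ) : kernelNorm a (gramKernel (fun i => x i - c) ^ l) ≤ (1 + 3 * r) ^ l * δ := by
  obtain ⟨s, hs, hxs⟩ := exists_seq_enumerating_of_norm_le ((norm_nonneg c).trans hc) hx
  simpa [newtonKernel] using kernelNorm_pow_sub_mul_newtonKernel_le hs hxs hδ0 hδ hc l 0

lemma hasSum_kernelForm_pow (a : ι → ℝ) (x : ι → E) :
    HasSum (fun l : ℕ => kernelForm a (gramKernel x ^ l) / l.factorial)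
      (kernelForm a fun i j => Real.exp ⟪x i, x j⟫_ℝ) := by
  simp_rw [kernelForm, Finset.sum_div]
  refine hasSum_sum fun i _ => hasSum_sum fun j _ => ?_
  have h := (NormedSpace.expSeries_div_hasSum_exp ⟪x i, x j⟫_ℝ).mul_left (a i * a j)
  rw [← Real.exp_eq_exp_ℝ] at h
  simpa only [mul_div_assoc, Pi.pow_apply, gramKernel] using h

lemma kernelForm_pow_div_factorial_le (a : ι → ℝ) (x : ι → E) (l : ℕ) :
    kernelForm a (gramKernel x ^ l) / l.factorial
      ≤ kernelForm a fun i j => Real.exp ⟪x i, x j⟫_ℝ :=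
  le_hasSum (hasSum_kernelForm_pow a x) l fun m _ => div_nonneg
    (kernelForm_nonneg a (pow_mem (gramKernel_mem_posSemidefKernel x) m)) (by positivity)

lemma kernelForm_exp_sub_le {M : ℝ} (hx : ∀ i, ‖x i‖ ≤ r) (hM0 : 0 ≤ M)
    (hM : ∀ l < Fintype.card ι, kernelForm a (gramKernel x ^ l) ≤ M) {c : E} (hc : ‖c‖ ≤ r) :
    kernelForm a (fun i j => Real.exp ⟪x i - c, x j - c⟫_ℝ) ≤ Real.exp ((1 + 3 * r) ^ 2) * M := by
  have hexp := (NormedSpace.expSeries_div_hasSum_exp ((1 + 3 * r) ^ 2)).mul_right M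
  rw [← Real.exp_eq_exp_ℝ] at hexp
  refine hasSum_le (fun l => ?_) (hasSum_kernelForm_pow a fun i => x i - c) hexp
  have hnorm := kernelNorm_pow_sub_le hx (Real.sqrt_nonneg M)
    (fun m hm => Real.sqrt_le_sqrt (hM m hm)) hc l
  calc kernelForm a (gramKernel (fun i => x i - c) ^ l) / l.factorial
      = kernelNorm a (gramKernel (fun i => x i - c) ^ l) ^ 2 / l.factorial := by
        rw [kernelNorm_sq a (pow_mem (gramKernel_mem_posSemidefKernel _) l)]
    _ ≤ ((1 + 3 * r) ^ l * √M) ^ 2 / l.factorial := by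
        gcongr
        exact kernelNorm_nonneg _ _
    _ = ((1 + 3 * r) ^ 2) ^ l / l.factorial * M := by
        rw [mul_pow, Real.sq_sqrt hM0, pow_right_comm]
        ring

end Kernel

section Divergence

variable {α : Type*} [MeasurableSpace α]

lemma sq_integral_mul_le {μ : Measure α} {f g : α → ℝ} (hf : MemLp f 2 μ) (hg : MemLp g 2 μ) :
    (∫ x, f x * g x ∂μ) ^ 2 ≤ (∫ x, f x ^ 2 ∂μ) * ∫ x, g x ^ 2 ∂μ := by
  have inner_toLp {u v : α → ℝ} (hu : MemLp u 2 μ) (hv : MemLp v 2 μ) :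
      inner ℝ (hu.toLp u) (hv.toLp v) = ∫ x, u x * v x ∂μ := by
    rw [L2.inner_def]
    refine integral_congr_ae ?_
    filter_upwards [hu.coeFn_toLp, hv.coeFn_toLp] with x hux hvx
    simp [hux, hvx, mul_comm]
  have h := real_inner_mul_inner_self_le (hf.toLp f) (hg.toLp g)
  simpa only [inner_toLp, ← sq] using h

lemma memLp_two_add_measure {μ ν : Measure α} {f : α → ℝ} (hμ : MemLp f 2 μ) (hν : MemLp f 2 ν) :
    MemLp f 2 (μ + ν) :=
  (memLp_two_iff_integrable_sq
    (hμ.aestronglyMeasurable.add_measure hν.aestronglyMeasurable)).2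
    (integrable_add_measure.2 ⟨hμ.integrable_sq, hν.integrable_sq⟩)

lemma hellingerSq_eq_lintegral_rnDeriv {P Q : Measure α} [IsFiniteMeasure P] [IsFiniteMeasure Q]
    (h : P ≪ Q) :
    hellingerSq P Q = ∫⁻ x, ENNReal.ofReal ((√(P.rnDeriv Q x).toReal - 1) ^ 2) ∂Q := by
  have hP : P ≪ P + Q := (Measure.le_add_right le_rfl).absolutelyContinuous
  have hQ : Q ≪ P + Q := (Measure.le_add_left le_rfl).absolutelyContinuous
  rw [hellingerSq, ← lintegral_rnDeriv_mul (h.add_left .rfl) (by fun_prop)]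
  refine lintegral_congr_ae ?_
  filter_upwards [Measure.rnDeriv_mul_rnDeriv (κ := Q) hP, Measure.rnDeriv_mul_rnDeriv (κ := Q) hQ,
    Q.rnDeriv_self, (P + Q).rnDeriv_lt_top Q] with x hPx hQx hQQ hfin
  set p := P.rnDeriv (P + Q) x
  set q := Q.rnDeriv (P + Q) x
  set s := (P + Q).rnDeriv Q x
  have hps : P.rnDeriv Q x = p * s := hPx.symm
  have hqs : √q.toReal * √s.toReal = 1 := by
    rw [← Real.sqrt_mul ENNReal.toReal_nonneg, ← ENNReal.toReal_mul]
    simp [show q * s = 1 from hQx.trans hQQ]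
  calc s * ENNReal.ofReal ((√p.toReal - √q.toReal) ^ 2)
      = ENNReal.ofReal (((√p.toReal - √q.toReal) * √s.toReal) ^ 2) := by
        rw [mul_pow, Real.sq_sqrt ENNReal.toReal_nonneg, mul_comm, ENNReal.ofReal_mul (sq_nonneg _),
          ENNReal.ofReal_toReal hfin.ne]
    _ = ENNReal.ofReal ((√(P.rnDeriv Q x).toReal - 1) ^ 2) := by
        rw [hps, ENNReal.toReal_mul, Real.sqrt_mul ENNReal.toReal_nonneg, sub_mul, hqs]

lemma sqrt_sub_one_sq_le_klFun {t : ℝ} (ht : 0 ≤ t) :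
    (√t - 1) ^ 2 ≤ InformationTheory.klFun t := by
  rcases ht.eq_or_lt with rfl | ht
  · simp [InformationTheory.klFun]
  have hs := Real.sqrt_pos.2 ht
  have hst : √t ^ 2 = t := Real.sq_sqrt ht.le
  have hlog : 1 - (√t)⁻¹ ≤ Real.log t / 2 := by
    rw [← Real.log_sqrt ht.le]
    exact Real.one_sub_inv_le_log_of_pos hs
  calc (√t - 1) ^ 2 = 2 * (√t ^ 2 * (1 - (√t)⁻¹)) + 1 - √t ^ 2 := by field_simp; ring
    _ ≤ 2 * (√t ^ 2 * (Real.log t / 2)) + 1 - √t ^ 2 := by gcongr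
    _ = InformationTheory.klFun t := by rw [InformationTheory.klFun_apply, hst]; ring

lemma klFun_le_sub_one_sq {t : ℝ} (ht : 0 ≤ t) : InformationTheory.klFun t ≤ (t - 1) ^ 2 := by
  rcases ht.eq_or_lt with rfl | ht
  · simp [InformationTheory.klFun]
  calc InformationTheory.klFun t = t * Real.log t + 1 - t := InformationTheory.klFun_apply t
    _ ≤ t * (t - 1) + 1 - t := by gcongr; exact Real.log_le_sub_one_of_pos ht
    _ = (t - 1) ^ 2 := by ring

variable (P Q : Measure α) [IsFiniteMeasure P] [IsFiniteMeasure Q]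

lemma hellingerSq_le_klDiv : hellingerSq P Q ≤ InformationTheory.klDiv P Q := by
  by_cases h : P ≪ Q
  · rw [hellingerSq_eq_lintegral_rnDeriv h, InformationTheory.klDiv_eq_lintegral_klFun_of_ac h]
    exact lintegral_mono fun x =>
      ENNReal.ofReal_le_ofReal (sqrt_sub_one_sq_le_klFun ENNReal.toReal_nonneg)
  · simp [InformationTheory.klDiv_of_not_ac h]

lemma klDiv_le_chiSqDiv : InformationTheory.klDiv P Q ≤ chiSqDiv P Q := by
  rw [chiSqDiv]
  split_ifs with h
  · rw [InformationTheory.klDiv_eq_lintegral_klFun_of_ac h]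
    exact lintegral_mono fun x =>
      ENNReal.ofReal_le_ofReal (klFun_le_sub_one_sq ENNReal.toReal_nonneg)
  · exact le_top

lemma memLp_sqrt_rnDeriv_mul {μ ν : Measure α} [IsFiniteMeasure μ] [IsFiniteMeasure ν]
    (hμν : μ ≤ ν) {f : α → ℝ} (hf : MemLp f 2 ν) :
    MemLp (fun x => √(μ.rnDeriv ν x).toReal * f x) 2 ν := by
  have hmeas : AEStronglyMeasurable (fun x => √(μ.rnDeriv ν x).toReal) ν :=
    Measurable.aestronglyMeasurable (by fun_prop)
  refine (memLp_two_iff_integrable_sq (hmeas.mul hf.aestronglyMeasurable)).2 ?_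
  simp only [Pi.mul_apply, mul_pow, Real.sq_sqrt ENNReal.toReal_nonneg]
  exact (integrable_rnDeriv_smul_iff (E := ℝ) hμν.absolutelyContinuous).2
    (hf.mono_measure hμν).integrable_sq

lemma integral_sqrt_rnDeriv_mul_mul {μ ν : Measure α} [IsFiniteMeasure μ] [IsFiniteMeasure ν]
    (hμν : μ ≤ ν) (f g : α → ℝ) :
    ∫ x, √(μ.rnDeriv ν x).toReal * f x * (√(μ.rnDeriv ν x).toReal * g x) ∂ν
      = ∫ x, f x * g x ∂μ := by
  simp_rw [mul_mul_mul_comm _ (f _), Real.mul_self_sqrt ENNReal.toReal_nonneg]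
  exact integral_rnDeriv_smul (E := ℝ) hμν.absolutelyContinuous

lemma hellingerSq_eq_ofReal_integral :
    hellingerSq P Q = ENNReal.ofReal (∫ x, (√(P.rnDeriv (P + Q) x).toReal
      - √(Q.rnDeriv (P + Q) x).toReal) ^ 2 ∂(P + Q)) := by
  have hP := memLp_sqrt_rnDeriv_mul (Measure.le_add_right le_rfl : P ≤ P + Q) (memLp_const 1)
  have hQ := memLp_sqrt_rnDeriv_mul (Measure.le_add_left le_rfl : Q ≤ P + Q) (memLp_const 1)
  have hint := (hP.sub hQ).integrable_sq
  simp only [mul_one, Pi.sub_apply] at hint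
  rw [ofReal_integral_eq_lintegral_ofReal hint (ae_of_all _ fun x => sq_nonneg _), hellingerSq]

variable {P Q}

lemma sq_integral_sub_integral_le {f : α → ℝ} (hfP : MemLp f 2 P) (hfQ : MemLp f 2 Q) :
    ENNReal.ofReal ((∫ x, f x ∂P - ∫ x, f x ∂Q) ^ 2)
      ≤ hellingerSq P Q * ENNReal.ofReal (2 * (∫ x, f x ^ 2 ∂P + ∫ x, f x ^ 2 ∂Q)) := by
  have hP : P ≤ P + Q := Measure.le_add_right le_rfl
  have hQ : Q ≤ P + Q := Measure.le_add_left le_rfl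
  have hf := memLp_two_add_measure hfP hfQ
  set u := fun x => √(P.rnDeriv (P + Q) x).toReal
  set v := fun x => √(Q.rnDeriv (P + Q) x).toReal
  have hu : MemLp u 2 (P + Q) := by simpa using memLp_sqrt_rnDeriv_mul hP (memLp_const 1)
  have hv : MemLp v 2 (P + Q) := by simpa using memLp_sqrt_rnDeriv_mul hQ (memLp_const 1)
  have huf : MemLp (fun x => u x * f x) 2 (P + Q) := memLp_sqrt_rnDeriv_mul hP hf
  have hvf : MemLp (fun x => v x * f x) 2 (P + Q) := memLp_sqrt_rnDeriv_mul hQ hf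
  have hPf : ∫ x, u x * (u x * f x) ∂(P + Q) = ∫ x, f x ∂P := by
    simpa using integral_sqrt_rnDeriv_mul_mul hP 1 f
  have hQf : ∫ x, v x * (v x * f x) ∂(P + Q) = ∫ x, f x ∂Q := by
    simpa using integral_sqrt_rnDeriv_mul_mul hQ 1 f
  have hdiff : ∫ x, f x ∂P - ∫ x, f x ∂Q
      = ∫ x, (u x - v x) * (u x * f x + v x * f x) ∂(P + Q) := by
    rw [← hPf, ← hQf]
    refine (integral_sub (hu.integrable_mul huf) (hv.integrable_mul hvf)).symm.trans ?_
    congr with x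
    simp only [Pi.mul_apply]
    ring
  have hsq : ∫ x, (u x * f x + v x * f x) ^ 2 ∂(P + Q)
      ≤ 2 * (∫ x, f x ^ 2 ∂P + ∫ x, f x ^ 2 ∂Q) := by
    have hPf2 := integral_sqrt_rnDeriv_mul_mul hP f f
    have hQf2 := integral_sqrt_rnDeriv_mul_mul hQ f f
    simp only [← sq] at hPf2 hQf2
    rw [← hPf2, ← hQf2, ← integral_add huf.integrable_sq hvf.integrable_sq, ← integral_const_mul]
    exact integral_mono (huf.add hvf).integrable_sq
      ((huf.integrable_sq.add hvf.integrable_sq).const_mul 2) fun x => add_sq_le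
  rw [hellingerSq_eq_ofReal_integral, ← ENNReal.ofReal_mul (by positivity), hdiff]
  refine ENNReal.ofReal_le_ofReal ((sq_integral_mul_le (hu.sub hv) (huf.add hvf)).trans ?_)
  exact mul_le_mul_of_nonneg_left hsq (integral_nonneg fun x => sq_nonneg _)


lemma chiSqDiv_withDensity {γ : Measure α} [SigmaFinite γ] {p q : α → ℝ} (hp : Measurable p)
    (hq : Measurable q) (hp0 : ∀ x, 0 ≤ p x) (hq0 : ∀ x, 0 < q x) :
    chiSqDiv (γ.withDensity fun x => ENNReal.ofReal (p x))
        (γ.withDensity fun x => ENNReal.ofReal (q x))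
      = ∫⁻ x, ENNReal.ofReal ((p x - q x) ^ 2 / q x) ∂γ := by
  set Q := γ.withDensity fun x => ENNReal.ofReal (q x) with hQ
  have : SigmaFinite Q := SigmaFinite.withDensity_of_ne_top' (by simp)
  have hPQ : (γ.withDensity fun x => ENNReal.ofReal (p x))
      = Q.withDensity fun x => ENNReal.ofReal (p x / q x) := by
    rw [hQ, ← withDensity_mul _ (by fun_prop) (by fun_prop)]
    congr with x
    rw [Pi.mul_apply, ← ENNReal.ofReal_mul (hq0 x).le, mul_div_cancel₀ _ (hq0 x).ne']
  have hrn : (Q.withDensity fun x => ENNReal.ofReal (p x / q x)).rnDeriv Q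
      =ᵐ[Q] fun x => ENNReal.ofReal (p x / q x) := Measure.rnDeriv_withDensity Q (by fun_prop)
  rw [hPQ, chiSqDiv, if_pos (withDensity_absolutelyContinuous _ _)]
  calc _ = ∫⁻ x, ENNReal.ofReal ((p x / q x - 1) ^ 2) ∂Q := lintegral_congr_ae <| by
        filter_upwards [hrn] with x hx
        rw [hx, ENNReal.toReal_ofReal (div_nonneg (hp0 x) (hq0 x).le)]
    _ = ∫⁻ x, ENNReal.ofReal (q x) * ENNReal.ofReal ((p x / q x - 1) ^ 2) ∂γ :=
        lintegral_withDensity_eq_lintegral_mul _ (by fun_prop) (by fun_prop)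
    _ = ∫⁻ x, ENNReal.ofReal ((p x - q x) ^ 2 / q x) ∂γ := lintegral_congr fun x => by
        have := (hq0 x).ne'
        rw [← ENNReal.ofReal_mul (hq0 x).le]
        congr 1
        field_simp

lemma hellingerSq_le_and_le_chiSqDiv (P Q : Measure α) [IsFiniteMeasure P] [IsFiniteMeasure Q]
    {D : Measure α → Measure α → ℝ≥0∞}
    (hD : D ∈ ({hellingerSq, InformationTheory.klDiv, chiSqDiv} :
      Set (Measure α → Measure α → ℝ≥0∞))) :
    hellingerSq P Q ≤ D P Q ∧ D P Q ≤ chiSqDiv P Q := by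
  have hHK := hellingerSq_le_klDiv P Q
  have hKX := klDiv_le_chiSqDiv P Q
  rcases hD with rfl | rfl | rfl
  exacts [⟨le_rfl, hHK.trans hKX⟩, ⟨hHK, hKX⟩, ⟨hHK.trans hKX, le_rfl⟩]

end Divergence

section Gaussian

open ProbabilityTheory InnerProductSpace

variable {E : Type*} [NormedAddCommGroup E] [InnerProductSpace ℝ E]

/-- The density of `N(u, 1)` with respect to the standard Gaussian measure. -/
noncomputable def gaussianShiftDensity (u x : E) : ℝ := Real.exp (⟪u, x⟫_ℝ - ‖u‖ ^ 2 / 2)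

lemma gaussianShiftDensity_pos (u x : E) : 0 < gaussianShiftDensity u x := Real.exp_pos _

lemma gaussianShiftDensity_eq_mul (u x : E) :
    gaussianShiftDensity u x = Real.exp (-(‖u‖ ^ 2 / 2)) * Real.exp ⟪u, x⟫_ℝ := by
  rw [gaussianShiftDensity, ← Real.exp_add, neg_add_eq_sub]

lemma gaussianShiftDensity_mul (u v x : E) :
    gaussianShiftDensity u x * gaussianShiftDensity v x
      = Real.exp ⟪u, v⟫_ℝ * gaussianShiftDensity (u + v) x := by
  simp_rw [gaussianShiftDensity, ← Real.exp_add, norm_add_sq_real, inner_add_left]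
  ring_nf

variable [MeasurableSpace E] [BorelSpace E]

@[fun_prop]
lemma measurable_gaussianShiftDensity (u : E) : Measurable (gaussianShiftDensity u) :=
  Continuous.measurable (by unfold gaussianShiftDensity; fun_prop)

variable [FiniteDimensional ℝ E]

lemma integral_cexp_inner_stdGaussian (u t : E) :
    ∫ x, Complex.exp (⟪u, x⟫_ℝ + ⟪x, t⟫_ℝ * Complex.I) ∂(stdGaussian E)
      = Complex.exp ((‖u‖ ^ 2 / 2 : ℝ) + ⟪u, t⟫_ℝ * Complex.I - (‖t‖ ^ 2 / 2 : ℝ)) := by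
  have hone (z : ℂ) :
      ∫ s : ℝ, Complex.exp (z * s) ∂(gaussianReal 0 1) = Complex.exp (z ^ 2 / 2) := by
    simpa [complexMGF] using complexMGF_id_gaussianReal (μ := 0) (v := 1) z
  set b := stdOrthonormalBasis ℝ E
  let z i : ℂ := ⟪u, b i⟫_ℝ + ⟪b i, t⟫_ℝ * Complex.I
  have hprod (y : Fin (Module.finrank ℝ E) → ℝ) :
      Complex.exp (⟪u, ∑ i, y i • b i⟫_ℝ + ⟪∑ i, y i • b i, t⟫_ℝ * Complex.I)
        = ∏ i, Complex.exp (z i * y i) := by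
    simp only [← Complex.exp_sum, inner_sum, sum_inner, real_inner_smul_left,
      real_inner_smul_right, Complex.ofReal_sum, Finset.sum_mul, ← Finset.sum_add_distrib, z]
    congr! 2 with i
    push_cast
    ring
  have hz : ∑ i, z i ^ 2 / 2
      = (‖u‖ ^ 2 / 2 : ℝ) + ⟪u, t⟫_ℝ * Complex.I - (‖t‖ ^ 2 / 2 : ℝ) := by
    rw [← b.sum_sq_inner_left u, ← b.sum_sq_inner_right t, ← b.sum_inner_mul_inner u t]
    push_cast [Finset.sum_mul, Finset.sum_div, ← Finset.sum_add_distrib, ← Finset.sum_sub_distrib]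
    congr! 1 with i
    linear_combination (⟪b i, t⟫_ℝ : ℂ) ^ 2 / 2 * Complex.I_sq
  rw [stdGaussian_eq_map_pi_orthonormalBasis b, integral_map
    (Measurable.aemeasurable (by fun_prop)) (Measurable.aestronglyMeasurable (by fun_prop))]
  simp_rw [hprod]
  rw [integral_fintype_prod_eq_prod (f := fun i (s : ℝ) => Complex.exp (z i * s))]
  simp_rw [hone, ← Complex.exp_sum, hz]

lemma integral_exp_inner_stdGaussian (u : E) :
    ∫ x, Real.exp ⟪u, x⟫_ℝ ∂(stdGaussian E) = Real.exp (‖u‖ ^ 2 / 2) := by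
  have h := integral_cexp_inner_stdGaussian u 0
  simp only [inner_zero_right, Complex.ofReal_zero, zero_mul, add_zero, norm_zero, ne_eq,
    OfNat.ofNat_ne_zero, not_false_eq_true, zero_pow, zero_div, sub_zero, ← Complex.ofReal_exp,
    integral_complex_ofReal] at h
  exact_mod_cast h

lemma integral_gaussianShiftDensity (u : E) :
    ∫ x, gaussianShiftDensity u x ∂(stdGaussian E) = 1 := by
  simp_rw [gaussianShiftDensity_eq_mul]
  rw [integral_const_mul, integral_exp_inner_stdGaussian, ← Real.exp_add, neg_add_cancel,
    Real.exp_zero]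

lemma integrable_gaussianShiftDensity (u : E) :
    Integrable (gaussianShiftDensity u) (stdGaussian E) :=
  .of_integral_ne_zero (by simp [integral_gaussianShiftDensity])

/-- **Cameron–Martin formula** for the standard Gaussian measure. -/
lemma map_const_add_stdGaussian (u : E) :
    (stdGaussian E).map (u + ·)
      = (stdGaussian E).withDensity fun x => ENNReal.ofReal (gaussianShiftDensity u x) := by
  have := isFiniteMeasure_withDensity_ofReal (integrable_gaussianShiftDensity u).2
  apply Measure.ext_of_charFun
  ext t
  have hcexp (x : E) : (ENNReal.ofReal (gaussianShiftDensity u x)).toReal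
      • Complex.exp (⟪x, t⟫_ℝ * Complex.I) = Complex.exp (-(‖u‖ ^ 2 / 2 : ℝ))
        * Complex.exp (⟪u, x⟫_ℝ + ⟪x, t⟫_ℝ * Complex.I) := by
    rw [ENNReal.toReal_ofReal (gaussianShiftDensity_pos u x).le, Complex.real_smul,
      gaussianShiftDensity, Complex.ofReal_exp, ← Complex.exp_add, ← Complex.exp_add]
    push_cast
    ring_nf
  rw [charFun_map_const_add, charFun_stdGaussian, ← Complex.exp_add, charFun_apply,
    integral_withDensity_eq_integral_toReal_smul (by fun_prop) (by simp)]
  simp_rw [hcexp]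
  rw [integral_const_mul, integral_cexp_inner_stdGaussian, ← Complex.exp_add]
  push_cast
  ring_nf

end Gaussian

section Mixture

open ProbabilityTheory InnerProductSpace

variable {E ι κ : Type*} [NormedAddCommGroup E] [InnerProductSpace ℝ E] [Fintype ι] [Fintype κ]

/-- The density with respect to the standard Gaussian measure of the Gaussian mixture with weights
`a` and centers `x`. The weights may be negative, so that the difference of two mixture densities
is again of this form. -/
noncomputable def mixtureDensity (a : ι → ℝ) (x : ι → E) (y : E) : ℝ :=
  ∑ i, a i * gaussianShiftDensity (x i) y

lemma mixtureDensity_nonneg {a : ι → ℝ} (ha : ∀ i, 0 ≤ a i) (x : ι → E) (y : E) :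
    0 ≤ mixtureDensity a x y :=
  Finset.sum_nonneg fun i _ => mul_nonneg (ha i) (gaussianShiftDensity_pos _ _).le

lemma mixtureDensity_sumElim_neg (w : ι → ℝ) (w' : κ → ℝ) (μ : ι → E) (μ' : κ → E) (y : E) :
    mixtureDensity (Sum.elim w (-w')) (Sum.elim μ μ') y
      = mixtureDensity w μ y - mixtureDensity w' μ' y := by
  simp [mixtureDensity, sub_eq_add_neg]

lemma mixtureDensity_mul_eq_sum (w : κ → ℝ) (μ : κ → E) (y : E) (t : ℝ) :
    mixtureDensity w μ y * t = ∑ j, w j * (gaussianShiftDensity (μ j) y * t) := by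
  simp_rw [mixtureDensity, Finset.sum_mul, mul_assoc]

lemma gaussianShiftDensity_mul_mixtureDensity_sq (a : ι → ℝ) (x : ι → E) (c y : E) :
    gaussianShiftDensity c y * mixtureDensity a x y ^ 2
      = ∑ i, ∑ j, Real.exp (-‖c‖ ^ 2) * (a i * a j * Real.exp ⟪x i + c, x j + c⟫_ℝ)
        * gaussianShiftDensity (x i + x j + c) y := by
  have htriple (i j : ι) : gaussianShiftDensity (x i) y * gaussianShiftDensity (x j) y
      * gaussianShiftDensity c y = Real.exp (-‖c‖ ^ 2) * Real.exp ⟪x i + c, x j + c⟫_ℝ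
        * gaussianShiftDensity (x i + x j + c) y := by
    rw [gaussianShiftDensity_mul, mul_assoc, gaussianShiftDensity_mul, ← mul_assoc, ← Real.exp_add,
      ← Real.exp_add]
    simp only [inner_add_left, inner_add_right, real_inner_self_eq_norm_sq,
      real_inner_comm (x j) c]
    ring_nf
  rw [mixtureDensity, sq, Finset.sum_mul_sum, Finset.mul_sum]
  simp_rw [Finset.mul_sum]
  congr! 2 with i _ j _
  linear_combination a i * a j * htriple i j

lemma norm_sum_smul_le_of_mem_stdSimplex {w : ι → ℝ} (hw : w ∈ stdSimplex ℝ ι) {μ : ι → E} {r : ℝ}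
    (hμ : ∀ i, ‖μ i‖ ≤ r) : ‖∑ i, w i • μ i‖ ≤ r :=
  mem_closedBall_zero_iff.1 <| (convex_closedBall 0 r).sum_mem (fun i _ => hw.1 i) hw.2
    fun i _ => mem_closedBall_zero_iff.2 (hμ i)

lemma exp_inner_sum_sub_le_mixtureDensity {w : ι → ℝ} (hw : w ∈ stdSimplex ℝ ι) {μ : ι → E} {r : ℝ}
    (hμ : ∀ i, ‖μ i‖ ≤ r) (y : E) :
    Real.exp (⟪∑ i, w i • μ i, y⟫_ℝ - r ^ 2 / 2) ≤ mixtureDensity w μ y := by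
  have hmean : ⟪∑ i, w i • μ i, y⟫_ℝ - r ^ 2 / 2 = ∑ i, w i * (⟪μ i, y⟫_ℝ - r ^ 2 / 2) := by
    simp_rw [mul_sub, Finset.sum_sub_distrib, ← Finset.sum_mul, hw.2, one_mul, sum_inner,
      real_inner_smul_left]
  calc Real.exp (⟪∑ i, w i • μ i, y⟫_ℝ - r ^ 2 / 2)
      ≤ ∑ i, w i * Real.exp (⟪μ i, y⟫_ℝ - r ^ 2 / 2) := by
        rw [hmean]
        exact convexOn_exp.map_sum_le (fun i _ => hw.1 i) hw.2 fun _ _ => Set.mem_univ _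
    _ ≤ mixtureDensity w μ y := by
        unfold mixtureDensity gaussianShiftDensity
        gcongr with i
        exacts [hw.1 i, hμ i]

lemma inv_mixtureDensity_le {w : ι → ℝ} (hw : w ∈ stdSimplex ℝ ι) {μ : ι → E} {r : ℝ}
    (hμ : ∀ i, ‖μ i‖ ≤ r) (y : E) :
    (mixtureDensity w μ y)⁻¹ ≤ Real.exp (r ^ 2) * gaussianShiftDensity (-∑ i, w i • μ i) y := by
  have hmean := pow_le_pow_left₀ (norm_nonneg _) (norm_sum_smul_le_of_mem_stdSimplex hw hμ) 2
  refine (inv_anti₀ (Real.exp_pos _) (exp_inner_sum_sub_le_mixtureDensity hw hμ y)).trans ?_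
  rw [← Real.exp_neg, gaussianShiftDensity, ← Real.exp_add, Real.exp_le_exp, inner_neg_left,
    norm_neg]
  linarith

variable [MeasurableSpace E]

/-- The atomic measure `∑ j, w j • δ_(μ j)`. Negative weights are replaced by zero. -/
noncomputable def atomicMeasure (w : ι → ℝ) (μ : ι → E) : Measure E :=
  ∑ j, ENNReal.ofReal (w j) • Measure.dirac (μ j)

instance isFiniteMeasure_atomicMeasure (w : ι → ℝ) (μ : ι → E) :
    IsFiniteMeasure (atomicMeasure w μ) :=
  ⟨by simp [atomicMeasure, Measure.finsetSum_apply, ENNReal.sum_lt_top]⟩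

variable [BorelSpace E]

@[fun_prop]
lemma measurable_mixtureDensity (a : ι → ℝ) (x : ι → E) : Measurable (mixtureDensity a x) := by
  unfold mixtureDensity
  fun_prop

variable [FiniteDimensional ℝ E]

lemma atomicMeasure_conv_stdGaussian {w : ι → ℝ} (hw : ∀ i, 0 ≤ w i) (μ : ι → E) :
    atomicMeasure w μ ∗ stdGaussian E
      = (stdGaussian E).withDensity fun y => ENNReal.ofReal (mixtureDensity w μ y) := by
  classical
  unfold atomicMeasure mixtureDensity
  induction (Finset.univ : Finset ι) using Finset.induction_on with
  | empty => simp
  | insert j s hj ih =>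
    have hs : IsFiniteMeasure (∑ j ∈ s, ENNReal.ofReal (w j) • Measure.dirac (μ j)) :=
      ⟨by simp [Measure.finsetSum_apply, ENNReal.sum_lt_top]⟩
    have hterm (i : ι) (y : E) : 0 ≤ w i * gaussianShiftDensity (μ i) y :=
      mul_nonneg (hw i) (gaussianShiftDensity_pos _ _).le
    have : IsFiniteMeasure (ENNReal.ofReal (w j) • Measure.dirac (μ j)) :=
      ⟨by simp⟩
    simp_rw [Finset.sum_insert hj]
    rw [Measure.add_conv, ih, Measure.conv_smul_left, Measure.dirac_conv,
      map_const_add_stdGaussian, ← withDensity_smul _ (by fun_prop),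
      ← withDensity_add_left (by fun_prop)]
    congr with y
    rw [Pi.add_apply, Pi.smul_apply, smul_eq_mul, ← ENNReal.ofReal_mul (hw j),
      ENNReal.ofReal_add (hterm j y) (Finset.sum_nonneg fun i _ => hterm i y)]

lemma integrable_atomicMeasure_conv_iff {w : ι → ℝ} (hw : ∀ i, 0 ≤ w i) {μ : ι → E} {f : E → ℝ} :
    Integrable f (atomicMeasure w μ ∗ stdGaussian E)
      ↔ Integrable (fun y => mixtureDensity w μ y * f y) (stdGaussian E) := by
  rw [atomicMeasure_conv_stdGaussian hw,
    integrable_withDensity_iff_integrable_smul' (by fun_prop) (by simp)]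
  simp_rw [ENNReal.toReal_ofReal (mixtureDensity_nonneg hw μ _), smul_eq_mul]

lemma integral_atomicMeasure_conv {w : ι → ℝ} (hw : ∀ i, 0 ≤ w i) (μ : ι → E) (f : E → ℝ) :
    ∫ y, f y ∂(atomicMeasure w μ ∗ stdGaussian E)
      = ∫ y, mixtureDensity w μ y * f y ∂(stdGaussian E) := by
  rw [atomicMeasure_conv_stdGaussian hw,
    integral_withDensity_eq_integral_toReal_smul (by fun_prop) (by simp)]
  simp_rw [ENNReal.toReal_ofReal (mixtureDensity_nonneg hw μ _), smul_eq_mul]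

lemma integrable_gaussianShiftDensity_mul_mixtureDensity_sq (a : ι → ℝ) (x : ι → E) (c : E) :
    Integrable (fun y => gaussianShiftDensity c y * mixtureDensity a x y ^ 2) (stdGaussian E) := by
  simp_rw [gaussianShiftDensity_mul_mixtureDensity_sq]
  exact integrable_finsetSum _ fun i _ => integrable_finsetSum _ fun j _ =>
    (integrable_gaussianShiftDensity _).const_mul _

lemma integral_gaussianShiftDensity_mul_mixtureDensity_sq (a : ι → ℝ) (x : ι → E) (c : E) :
    ∫ y, gaussianShiftDensity c y * mixtureDensity a x y ^ 2 ∂(stdGaussian E)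
      = Real.exp (-‖c‖ ^ 2) * kernelForm a fun i j => Real.exp ⟪x i + c, x j + c⟫_ℝ := by
  have hint (i j : ι) := (integrable_gaussianShiftDensity (x i + x j + c)).const_mul
    (Real.exp (-‖c‖ ^ 2) * (a i * a j * Real.exp ⟪x i + c, x j + c⟫_ℝ))
  simp_rw [gaussianShiftDensity_mul_mixtureDensity_sq]
  rw [integral_finsetSum _ fun i _ => integrable_finsetSum _ fun j _ => hint i j]
  simp_rw [integral_finsetSum _ fun j _ => hint _ j, integral_const_mul,
    integral_gaussianShiftDensity, mul_one, kernelForm, Finset.mul_sum]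

variable {a : ι → ℝ} {x : ι → E} {r M : ℝ}

lemma integral_gaussianShiftDensity_mul_mixtureDensity_sq_le (hx : ∀ i, ‖x i‖ ≤ r) (hM0 : 0 ≤ M)
    (hM : ∀ l < Fintype.card ι, kernelForm a (gramKernel x ^ l) ≤ M) {c : E} (hc : ‖c‖ ≤ r) :
    ∫ y, gaussianShiftDensity c y * mixtureDensity a x y ^ 2 ∂(stdGaussian E)
      ≤ Real.exp ((1 + 3 * r) ^ 2) * M := by
  have hform := kernelForm_exp_sub_le hx hM0 hM (c := -c) (by rwa [norm_neg])
  simp only [sub_neg_eq_add] at hform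
  rw [integral_gaussianShiftDensity_mul_mixtureDensity_sq]
  calc _ ≤ Real.exp (-‖c‖ ^ 2) * (Real.exp ((1 + 3 * r) ^ 2) * M) := by gcongr
    _ ≤ Real.exp ((1 + 3 * r) ^ 2) * M :=
      mul_le_of_le_one_left (by positivity) (Real.exp_le_one_iff.2 (by simp))

lemma memLp_mixtureDensity (a : ι → ℝ) (x : ι → E) {w : κ → ℝ} (hw : ∀ j, 0 ≤ w j) (μ : κ → E) :
    MemLp (mixtureDensity a x) 2 (atomicMeasure w μ ∗ stdGaussian E) := by
  refine (memLp_two_iff_integrable_sq (by fun_prop)).2 ?_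
  simp_rw [integrable_atomicMeasure_conv_iff hw, mixtureDensity_mul_eq_sum w μ]
  exact integrable_finsetSum _ fun j _ =>
    (integrable_gaussianShiftDensity_mul_mixtureDensity_sq a x (μ j)).const_mul _

lemma integral_mixtureDensity_sq_le (hx : ∀ i, ‖x i‖ ≤ r) (hM0 : 0 ≤ M)
    (hM : ∀ l < Fintype.card ι, kernelForm a (gramKernel x ^ l) ≤ M) {w : κ → ℝ} {μ : κ → E}
    (hw : w ∈ stdSimplex ℝ κ) (hμ : ∀ j, ‖μ j‖ ≤ r) :
    ∫ y, mixtureDensity a x y ^ 2 ∂(atomicMeasure w μ ∗ stdGaussian E)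
      ≤ Real.exp ((1 + 3 * r) ^ 2) * M := by
  have hint (j : κ) :=
    (integrable_gaussianShiftDensity_mul_mixtureDensity_sq a x (μ j)).const_mul (w j)
  simp_rw [integral_atomicMeasure_conv hw.1, mixtureDensity_mul_eq_sum w μ]
  rw [integral_finsetSum _ fun j _ => hint j]
  simp_rw [integral_const_mul]
  calc _ ≤ ∑ j, w j * (Real.exp ((1 + 3 * r) ^ 2) * M) := by
        gcongr with j
        exacts [hw.1 j, integral_gaussianShiftDensity_mul_mixtureDensity_sq_le hx hM0 hM (hμ j)]
    _ = Real.exp ((1 + 3 * r) ^ 2) * M := by rw [← Finset.sum_mul, hw.2, one_mul]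

variable {w : ι → ℝ} {w' : κ → ℝ} {μ : ι → E} {μ' : κ → E}

lemma chiSqDiv_conv_stdGaussian_le (hw : ∀ i, 0 ≤ w i) (hw' : w' ∈ stdSimplex ℝ κ)
    (hμ : ∀ i, ‖μ i‖ ≤ r) (hμ' : ∀ j, ‖μ' j‖ ≤ r) (hM0 : 0 ≤ M)
    (hM : ∀ l < Fintype.card (ι ⊕ κ),
      kernelForm (Sum.elim w (-w')) (gramKernel (Sum.elim μ μ') ^ l) ≤ M) :
    chiSqDiv (atomicMeasure w μ ∗ stdGaussian E) (atomicMeasure w' μ' ∗ stdGaussian E)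
      ≤ ENNReal.ofReal (Real.exp (r ^ 2) * (Real.exp ((1 + 3 * r) ^ 2) * M)) := by
  have hpos (y : E) : 0 < mixtureDensity w' μ' y :=
    (Real.exp_pos _).trans_le (exp_inner_sum_sub_le_mixtureDensity hw' hμ' y)
  set f := mixtureDensity (Sum.elim w (-w')) (Sum.elim μ μ') with hf
  set c := -∑ j, w' j • μ' j with hc
  have hcr : ‖c‖ ≤ r := by rw [hc, norm_neg]; exact norm_sum_smul_le_of_mem_stdSimplex hw' hμ'
  have hint : Integrable (fun y => Real.exp (r ^ 2) * (gaussianShiftDensity c y * f y ^ 2))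
      (stdGaussian E) :=
    (integrable_gaussianShiftDensity_mul_mixtureDensity_sq _ _ c).const_mul _
  rw [atomicMeasure_conv_stdGaussian hw, atomicMeasure_conv_stdGaussian hw'.1,
    chiSqDiv_withDensity (by fun_prop) (by fun_prop) (mixtureDensity_nonneg hw μ) hpos]
  simp_rw [← mixtureDensity_sumElim_neg, ← hf]
  calc ∫⁻ y, ENNReal.ofReal (f y ^ 2 / mixtureDensity w' μ' y) ∂(stdGaussian E)
      ≤ ∫⁻ y, ENNReal.ofReal (Real.exp (r ^ 2) * (gaussianShiftDensity c y * f y ^ 2))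
          ∂(stdGaussian E) := by
        gcongr with y
        rw [div_eq_inv_mul, ← mul_assoc]
        exact mul_le_mul_of_nonneg_right (inv_mixtureDensity_le hw' hμ' y) (sq_nonneg _)
    _ = ENNReal.ofReal (Real.exp (r ^ 2)
          * ∫ y, gaussianShiftDensity c y * f y ^ 2 ∂(stdGaussian E)) := by
        rw [← integral_const_mul, ofReal_integral_eq_lintegral_ofReal hint]
        exact ae_of_all _ fun y => mul_nonneg (Real.exp_pos _).le
          (mul_nonneg (gaussianShiftDensity_pos _ _).le (sq_nonneg _))
    _ ≤ _ := by
        gcongr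
        exact integral_gaussianShiftDensity_mul_mixtureDensity_sq_le
          (Sum.forall.2 ⟨hμ, hμ'⟩) hM0 hM hcr

lemma integral_mixtureDensity_sub_integral_mixtureDensity (hw : ∀ i, 0 ≤ w i)
    (hw' : ∀ j, 0 ≤ w' j) (μ : ι → E) (μ' : κ → E) :
    ∫ y, mixtureDensity (Sum.elim w (-w')) (Sum.elim μ μ') y ∂(atomicMeasure w μ ∗ stdGaussian E)
        - ∫ y, mixtureDensity (Sum.elim w (-w')) (Sum.elim μ μ') y
          ∂(atomicMeasure w' μ' ∗ stdGaussian E)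
      = kernelForm (Sum.elim w (-w')) fun i j =>
          Real.exp ⟪Sum.elim μ μ' i, Sum.elim μ μ' j⟫_ℝ := by
  have hint := (memLp_mixtureDensity (Sum.elim w (-w')) (Sum.elim μ μ') hw μ).integrable one_le_two
  have hint' :=
    (memLp_mixtureDensity (Sum.elim w (-w')) (Sum.elim μ μ') hw' μ').integrable one_le_two
  have hsq := integral_gaussianShiftDensity_mul_mixtureDensity_sq
    (Sum.elim w (-w')) (Sum.elim μ μ') 0
  simp only [gaussianShiftDensity, inner_zero_left, norm_zero, ne_eq, OfNat.ofNat_ne_zero,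
    not_false_eq_true, zero_pow, zero_div, sub_zero, Real.exp_zero, one_mul, neg_zero,
    add_zero] at hsq
  rw [integrable_atomicMeasure_conv_iff hw] at hint
  rw [integrable_atomicMeasure_conv_iff hw'] at hint'
  rw [integral_atomicMeasure_conv hw, integral_atomicMeasure_conv hw', ← hsq,
    ← integral_sub hint hint']
  simp_rw [← sub_mul, ← mixtureDensity_sumElim_neg, ← sq]

lemma sq_kernelForm_pow_le_hellingerSq_mul (hw : w ∈ stdSimplex ℝ ι) (hw' : w' ∈ stdSimplex ℝ κ)
    (hμ : ∀ i, ‖μ i‖ ≤ r) (hμ' : ∀ j, ‖μ' j‖ ≤ r) (hM0 : 0 ≤ M)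
    (hM : ∀ l < Fintype.card (ι ⊕ κ),
      kernelForm (Sum.elim w (-w')) (gramKernel (Sum.elim μ μ') ^ l) ≤ M) (l : ℕ) :
    ENNReal.ofReal ((kernelForm (Sum.elim w (-w')) (gramKernel (Sum.elim μ μ') ^ l)
        / l.factorial) ^ 2)
      ≤ hellingerSq (atomicMeasure w μ ∗ stdGaussian E) (atomicMeasure w' μ' ∗ stdGaussian E)
        * ENNReal.ofReal (4 * Real.exp ((1 + 3 * r) ^ 2) * M) := by
  set a := Sum.elim w (-w')
  set x := Sum.elim μ μ'
  have hx : ∀ i, ‖x i‖ ≤ r := Sum.forall.2 ⟨hμ, hμ'⟩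
  have hP : MemLp (mixtureDensity a x) 2 (atomicMeasure w μ ∗ stdGaussian E) :=
    memLp_mixtureDensity a x hw.1 μ
  have hQ : MemLp (mixtureDensity a x) 2 (atomicMeasure w' μ' ∗ stdGaussian E) :=
    memLp_mixtureDensity a x hw'.1 μ'
  have hPsq := integral_mixtureDensity_sq_le hx hM0 hM hw hμ
  have hQsq := integral_mixtureDensity_sq_le hx hM0 hM hw' hμ'
  have hform0 : 0 ≤ kernelForm a (gramKernel x ^ l) :=
    kernelForm_nonneg a (pow_mem (gramKernel_mem_posSemidefKernel x) l)
  have htest := sq_integral_sub_integral_le hP hQ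
  rw [integral_mixtureDensity_sub_integral_mixtureDensity hw.1 hw'.1] at htest
  refine le_trans ?_ (htest.trans ?_)
  · gcongr
    exact kernelForm_pow_div_factorial_le a x l
  · gcongr hellingerSq _ _ * ENNReal.ofReal ?_
    linarith

lemma ofReal_inv_mul_kernelForm_pow_le_hellingerSq (hw : w ∈ stdSimplex ℝ ι)
    (hw' : w' ∈ stdSimplex ℝ κ) (hμ : ∀ i, ‖μ i‖ ≤ r) (hμ' : ∀ j, ‖μ' j‖ ≤ r) {l : ℕ}
    (hl : ∀ m < Fintype.card (ι ⊕ κ),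
      kernelForm (Sum.elim w (-w')) (gramKernel (Sum.elim μ μ') ^ m)
        ≤ kernelForm (Sum.elim w (-w')) (gramKernel (Sum.elim μ μ') ^ l)) :
    ENNReal.ofReal ((4 * Real.exp ((1 + 3 * r) ^ 2) * (l.factorial : ℝ) ^ 2)⁻¹
        * kernelForm (Sum.elim w (-w')) (gramKernel (Sum.elim μ μ') ^ l))
      ≤ hellingerSq (atomicMeasure w μ ∗ stdGaussian E) (atomicMeasure w' μ' ∗ stdGaussian E) := by
  have hM0 := kernelForm_nonneg (Sum.elim w (-w'))
    (pow_mem (gramKernel_mem_posSemidefKernel (Sum.elim μ μ')) l)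
  have h := sq_kernelForm_pow_le_hellingerSq_mul hw hw' hμ hμ' hM0 hl l
  set M := kernelForm (Sum.elim w (-w')) (gramKernel (Sum.elim μ μ') ^ l)
  rcases hM0.eq_or_lt with hM | hM
  · simp [← hM]
  convert ENNReal.div_le_of_le_mul h
  rw [← ENNReal.ofReal_div_of_pos (by positivity)]
  congr 1
  field_simp

end Mixture

section Moments

variable {d : ℕ} {ι κ : Type*} [Fintype ι] [Fintype κ]

lemma momentTensor_atomicMeasure {w : ι → ℝ} (hw : ∀ j, 0 ≤ w j) (μ : ι → Rd d) (l : ℕ)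
    (e : Fin l → Fin d) :
    momentTensor l (atomicMeasure w μ) e = ∑ j, w j * ∏ s, μ j (e s) := by
  rw [momentTensor, atomicMeasure, integral_finsetSum_measure fun j _ =>
    Integrable.smul_measure (integrable_dirac (by simp)) (by simp)]
  simp_rw [integral_smul_measure, integral_dirac, ENNReal.toReal_ofReal (hw _), smul_eq_mul]

lemma kernelForm_gramKernel_pow (a : ι → ℝ) (x : ι → Rd d) (l : ℕ) :
    kernelForm a (gramKernel x ^ l) = ∑ e : Fin l → Fin d, (∑ i, a i * ∏ s, x i (e s)) ^ 2 := by
  have hpow (i j : ι) : (gramKernel x ^ l) i j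
      = ∑ e : Fin l → Fin d, (∏ s, x i (e s)) * ∏ s, x j (e s) := by
    simp_rw [Pi.pow_apply, gramKernel, PiLp.inner_apply, RCLike.inner_apply, conj_trivial,
      Finset.sum_pow', Fintype.piFinset_univ, Finset.prod_mul_distrib]
    simp [mul_comm]
  simp_rw [kernelForm, hpow, Finset.mul_sum, sq, Finset.sum_mul_sum]
  rw [Finset.sum_comm_cycle]
  congr! 3
  ring

lemma frobeniusNorm_momentTensor_sub_sq {w : ι → ℝ} {w' : κ → ℝ} (hw : ∀ j, 0 ≤ w j)
    (hw' : ∀ j, 0 ≤ w' j) (μ : ι → Rd d) (μ' : κ → Rd d) (l : ℕ) :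
    frobeniusNorm (momentTensor l (atomicMeasure w μ) - momentTensor l (atomicMeasure w' μ')) ^ 2
      = kernelForm (Sum.elim w (-w')) (gramKernel (Sum.elim μ μ') ^ l) := by
  rw [frobeniusNorm, Real.sq_sqrt (by positivity), kernelForm_gramKernel_pow]
  congr! 2 with e
  simp [momentTensor_atomicMeasure hw, momentTensor_atomicMeasure hw', sub_eq_add_neg]

variable {w : ι → ℝ} {w' : κ → ℝ}

lemma kernelForm_pow_le_maxMomentDiffSq (hw : ∀ j, 0 ≤ w j) (hw' : ∀ j, 0 ≤ w' j) (μ : ι → Rd d)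
    (μ' : κ → Rd d) {k l : ℕ} (hl : l ≤ 2 * k - 1) :
    kernelForm (Sum.elim w (-w')) (gramKernel (Sum.elim μ μ') ^ l)
      ≤ maxMomentDiffSq k (atomicMeasure w μ) (atomicMeasure w' μ') := by
  rw [← frobeniusNorm_momentTensor_sub_sq hw hw']
  exact Finset.le_sup' (fun l => frobeniusNorm (momentTensor l (atomicMeasure w μ)
    - momentTensor l (atomicMeasure w' μ')) ^ 2) (Finset.mem_Iic.2 hl)

lemma exists_maxMomentDiffSq_eq_kernelForm_pow (hw : ∀ j, 0 ≤ w j) (hw' : ∀ j, 0 ≤ w' j)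
    (μ : ι → Rd d) (μ' : κ → Rd d) (k : ℕ) :
    ∃ l ≤ 2 * k - 1, maxMomentDiffSq k (atomicMeasure w μ) (atomicMeasure w' μ')
      = kernelForm (Sum.elim w (-w')) (gramKernel (Sum.elim μ μ') ^ l) := by
  simp_rw [← frobeniusNorm_momentTensor_sub_sq hw hw' μ μ', ← Finset.mem_Iic]
  exact Finset.exists_mem_eq_sup' _ _

variable {k : ℕ} {R : ℝ} {Γ Γ' : Measure (Rd d)}

lemma maxMomentDiffSq_nonneg (k : ℕ) (Γ Γ' : Measure (Rd d)) : 0 ≤ maxMomentDiffSq k Γ Γ' :=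
  (sq_nonneg _).trans <| Finset.le_sup' (fun l => frobeniusNorm (momentTensor l Γ
    - momentTensor l Γ') ^ 2) (Finset.mem_Iic.2 (Nat.zero_le _))

lemma isFiniteMeasure_gaussianMixture (hΓ : Γ ∈ kAtomic k d R) :
    IsFiniteMeasure (gaussianMixture Γ) := by
  obtain ⟨w, μ, -, -, -, rfl⟩ := hΓ
  exact inferInstanceAs (IsFiniteMeasure (atomicMeasure w μ ∗ ProbabilityTheory.stdGaussian (Rd d)))

lemma chiSqDiv_gaussianMixture_le (hΓ : Γ ∈ kAtomic k d R) (hΓ' : Γ' ∈ kAtomic k d R) :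
    chiSqDiv (gaussianMixture Γ) (gaussianMixture Γ')
      ≤ ENNReal.ofReal (Real.exp (R ^ 2)
        * (Real.exp ((1 + 3 * R) ^ 2) * maxMomentDiffSq k Γ Γ')) := by
  have hM0 := maxMomentDiffSq_nonneg k Γ Γ'
  obtain ⟨w, μ, hw, -, hμ, rfl⟩ := hΓ
  obtain ⟨w', μ', hw', hw1', hμ', rfl⟩ := hΓ'
  refine chiSqDiv_conv_stdGaussian_le hw ⟨hw', hw1'⟩ hμ hμ' hM0 fun l hl =>
    kernelForm_pow_le_maxMomentDiffSq hw hw' μ μ' ?_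
  rw [Fintype.card_sum, Fintype.card_fin] at hl
  omega

lemma ofReal_inv_mul_maxMomentDiffSq_le_hellingerSq (hΓ : Γ ∈ kAtomic k d R)
    (hΓ' : Γ' ∈ kAtomic k d R) :
    ENNReal.ofReal ((4 * Real.exp ((1 + 3 * R) ^ 2) * ((2 * k - 1).factorial : ℝ) ^ 2)⁻¹
        * maxMomentDiffSq k Γ Γ')
      ≤ hellingerSq (gaussianMixture Γ) (gaussianMixture Γ') := by
  have hM0 := maxMomentDiffSq_nonneg k Γ Γ'
  obtain ⟨w, μ, hw, hw1, hμ, rfl⟩ := hΓ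
  obtain ⟨w', μ', hw', hw1', hμ', rfl⟩ := hΓ'
  obtain ⟨l, hl, hmax⟩ := exists_maxMomentDiffSq_eq_kernelForm_pow hw hw' μ μ' k
  refine le_trans (ENNReal.ofReal_le_ofReal ?_) <| ofReal_inv_mul_kernelForm_pow_le_hellingerSq
    ⟨hw, hw1⟩ ⟨hw', hw1'⟩ hμ hμ' (l := l) fun m hm => ?_
  · rw [← hmax]
    exact mul_le_mul_of_nonneg_right (by gcongr) hM0
  · rw [Fintype.card_sum, Fintype.card_fin] at hm
    rw [← hmax]
    exact kernelForm_pow_le_maxMomentDiffSq hw hw' μ μ' (by omega)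

lemma four_mul_factorial_sq_le {K : ℝ} (hk : 1 ≤ k) (hK : 1 ≤ K) :
    4 * K * ((2 * k - 1).factorial : ℝ) ^ 2 ≤ (8 * K * k) ^ (4 * k) := by
  have hfact : ((2 * k - 1).factorial : ℝ) ≤ (2 * k) ^ (2 * k) := by
    exact_mod_cast (Nat.factorial_le (by omega)).trans (Nat.factorial_le_pow (2 * k))
  have hpow : 4 * K ≤ (4 * K) ^ (4 * k) := le_self_pow₀ (by linarith) (by omega)
  calc 4 * K * ((2 * k - 1).factorial : ℝ) ^ 2
      ≤ (4 * K) ^ (4 * k) * ((2 * (k : ℝ)) ^ (2 * k)) ^ 2 := by gcongr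
    _ = (4 * K * (2 * k)) ^ (4 * k) := by rw [mul_pow (4 * K), ← pow_mul]; congr 2; ring
    _ = (8 * K * k) ^ (4 * k) := by congr 1; ring

end Moments

theorem mainTheorem3_general (R : ℝ) :
    ∃ C : ℝ, 0 < C ∧
      ∀ k d : ℕ, 1 ≤ k →
        ∀ Γ ∈ kAtomic k d R, ∀ Γ' ∈ kAtomic k d R,
          ∀ D ∈ ({hellingerSq, InformationTheory.klDiv, chiSqDiv} :
              Set (Measure (Rd d) → Measure (Rd d) → ℝ≥0∞)),
            ENNReal.ofReal (((C * k) ^ (4 * k))⁻¹ * maxMomentDiffSq k Γ Γ')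
                ≤ D (gaussianMixture Γ) (gaussianMixture Γ') ∧
              D (gaussianMixture Γ) (gaussianMixture Γ')
                ≤ ENNReal.ofReal (C * maxMomentDiffSq k Γ Γ') := by
  set K := Real.exp (R ^ 2 + (1 + 3 * R) ^ 2)
  have hK1 : 1 ≤ K := Real.one_le_exp (by positivity)
  refine ⟨8 * K, by positivity, fun k d hk Γ hΓ Γ' hΓ' D hD => ?_⟩
  have hM0 := maxMomentDiffSq_nonneg k Γ Γ'
  have := isFiniteMeasure_gaussianMixture hΓ
  have := isFiniteMeasure_gaussianMixture hΓ'
  have hD' := hellingerSq_le_and_le_chiSqDiv (gaussianMixture Γ) (gaussianMixture Γ') hD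
  constructor
  · refine le_trans (ENNReal.ofReal_le_ofReal ?_)
      ((ofReal_inv_mul_maxMomentDiffSq_le_hellingerSq hΓ hΓ').trans hD'.1)
    have hconst : 4 * Real.exp ((1 + 3 * R) ^ 2) * ((2 * k - 1).factorial : ℝ) ^ 2
        ≤ (8 * K * k) ^ (4 * k) := by
      refine le_trans ?_ (four_mul_factorial_sq_le hk hK1)
      gcongr
      exact Real.exp_le_exp.2 (le_add_of_nonneg_left (sq_nonneg R))
    gcongr
  · refine (hD'.2.trans (chiSqDiv_gaussianMixture_le hΓ hΓ')).trans (ENNReal.ofReal_le_ofReal ?_)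
    rw [← mul_assoc, ← Real.exp_add]
    gcongr
    linarith

theorem mainTheorem3 (R : ℝ) (hR : 0 ≤ R) :
    ∃ C : ℝ, 0 < C ∧
      ∀ k d : ℕ, 1 ≤ k →
        ∀ Γ ∈ kAtomic k d R, ∀ Γ' ∈ kAtomic k d R,
          ∀ D ∈ ({hellingerSq, InformationTheory.klDiv, chiSqDiv} :
              Set (Measure (Rd d) → Measure (Rd d) → ℝ≥0∞)),
            ENNReal.ofReal (((C * k) ^ (4 * k))⁻¹ * maxMomentDiffSq k Γ Γ')
                ≤ D (gaussianMixture Γ) (gaussianMixture Γ') ∧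
              D (gaussianMixture Γ) (gaussianMixture Γ')
                ≤ ENNReal.ofReal (C * Real.exp (36 * (k : ℝ) ^ 2) * maxMomentDiffSq k Γ Γ') := by
  obtain ⟨C, hC, hbound⟩ := mainTheorem3_general R
  refine ⟨C, hC, fun k d hk Γ hΓ Γ' hΓ' D hD => (hbound k d hk Γ hΓ Γ' hΓ' D hD).imp_right
    fun h => h.trans <| ENNReal.ofReal_le_ofReal ?_⟩
  have hM0 := maxMomentDiffSq_nonneg k Γ Γ'
  gcongr
  exact le_mul_of_one_le_right hC.le (Real.one_le_exp (by positivity))
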